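/- Let $G$ be a finite group. A rational $G$-Mackey functor $M$ consists of a $\mathbb{Q}$-vector space $M(G/H)$ for each subgroup $H\le G$ and $\mathbb{Q}$-linear restriction maps $R^H_K\colon M(G/H)\to M(G/K)$, induction maps $I^H_K\colon M(G/K)\to M(G/H)$ (for $K\le H$) and conjugation maps $C_g\colon M(G/H)\to M(G/gHg^{-1})$ (for $g\in G$) such that: $R^H_H=I^H_H=\mathrm{id}$, and $C_h=\mathrm{id}$ on $M(G/H)$ for $h\in H$; restriction, induction and conjugation are transitive ($R^H_L=R^K_LR^H_K$, $I^H_L=I^H_KI^K_L$, $C_{gh}=C_gC_h$); conjugation commutes with restriction and induction; and for $K,L\le H$ the Mackey axiom $$R^H_K\circ I^H_L=\sum_{x\in[K\backslash H/L]} I^K_{K\cap xLx^{-1}}\circ C_x\circ R^L_{L\cap x^{-1}Kx}$$ holds. For $H\le G$ let $A_{\mathbb{Q}}(H)$ be the rational Burnside ring (the rational Grothendieck ring of finite $H$-sets). It acts on $M(G/H)$ by extending $[H/L]\mapsto I^H_L\circ R^H_L$ linearly. For $K\le H$ let $e_K^H\in A_{\mathbb{Q}}(H)$ be the idempotent characterised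 by $|(e_K^H)^L|=1$ if $L$ is $H$-conjugate to $K$ and $|(e_K^H)^L|=0$ for every other subgroup $L\le H$, where $X\mapsto |X^L|$ is extended linearly to $A_{\mathbb{Q}}(H)$. The Weyl group $W_HK=N_HK/K$ acts on $M(G/K)$ through the conjugation maps. Theorem. For every finite group $G$, every rational $G$-Mackey functor $M$ and all subgroups $K\le H\le G$, there is an isomorphism of $\mathbb{Q}$-vector spaces $$e_K^H M(G/H)\;\cong\;\big(e_K^K M(G/K)\big)^{W_HK};$$ more precisely, the restriction map $R^H_K\colon M(G/H)\to M(G/K)$ restricts to such an isomorphism. -/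

import Mathlib

universe u v

/-- The conjugate `g H g⁻¹` of a subgroup. -/
def conjSub {G : Type*} [Group G] (g : G) (H : Subgroup G) : Subgroup G :=
  H.map (MulAut.conj g).toMonoidHom

section conjSub

variable {G : Type*} [Group G]

theorem mem_conjSub {g x : G} {H : Subgroup G} : x ∈ conjSub g H ↔ g⁻¹ * x * g ∈ H := by
  rw [conjSub, Subgroup.mem_map]
  constructor
  · rintro ⟨y, hy, rfl⟩
    simpa [mul_assoc] using hy
  · intro h
    exact ⟨_, h, by simp [mul_assoc]⟩

theorem conjSub_one (H : Subgroup G) : conjSub 1 H = H := by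
  ext x
  simp [mem_conjSub]

theorem conjSub_conjSub (g h : G) (H : Subgroup G) :
    conjSub g (conjSub h H) = conjSub (g * h) H := by
  ext x
  simp [mem_conjSub, mul_assoc]

theorem conjSub_mono (g : G) {K H : Subgroup G} (h : K ≤ H) : conjSub g K ≤ conjSub g H :=
  Subgroup.map_mono h

theorem conjSub_self {H : Subgroup G} {h : G} (hh : h ∈ H) : H = conjSub h H := by
  ext x
  rw [mem_conjSub, H.mul_mem_cancel_right hh, H.mul_mem_cancel_left (H.inv_mem hh)]

theorem card_conjSub (g : G) (H : Subgroup G) : Nat.card (conjSub g H) = Nat.card H :=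
  Subgroup.card_map_of_injective (MulAut.conj g).injective

end conjSub

/-! ### Finite `H`-sets and the rational Burnside ring -/

/-- A finite set with a left action of the group `H`. -/
structure FinGSet (H : Type u) [Group H] where
  carrier : Type u
  [action : MulAction H carrier]
  [finite : Finite carrier]

namespace FinGSet

variable {H : Type u} [Group H]

instance instAction (X : FinGSet H) : MulAction H X.carrier := X.action

instance instFinite (X : FinGSet H) : Finite X.carrier := X.finite

/-- Two finite `H`-sets are isomorphic if there is an equivariant bijection between them. -/
def Iso (X Y : FinGSet H) : Prop :=
  ∃ e : X.carrier ≃ Y.carrier, ∀ (h : H) (x : X.carrier), e (h • x) = h • e x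

instance isoSetoid (H : Type u) [Group H] : Setoid (FinGSet H) where
  r := Iso
  iseqv :=
    { refl := fun _ => ⟨Equiv.refl _, fun _ _ => rfl⟩
      symm := by
        rintro X Y ⟨e, he⟩
        refine ⟨e.symm, fun h y => ?_⟩
        rw [Equiv.symm_apply_eq, he, Equiv.apply_symm_apply]
      trans := by
        rintro X Y Z ⟨e, he⟩ ⟨f, hf⟩
        exact ⟨e.trans f, fun h x => by simp [he, hf]⟩ }

/-- The disjoint union of two finite `H`-sets. -/
def sum (X Y : FinGSet H) : FinGSet H where
  carrier := X.carrier ⊕ Y.carrier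
  action :=
    { smul := fun h => Sum.map (fun x => h • x) (fun y => h • y)
      one_smul := by
        rintro (x | y)
        · exact congrArg Sum.inl (one_smul H x)
        · exact congrArg Sum.inr (one_smul H y)
      mul_smul := by
        rintro g h (x | y)
        · exact congrArg Sum.inl (mul_smul g h x)
        · exact congrArg Sum.inr (mul_smul g h y) }

/-- The cartesian product of two finite `H`-sets, with the diagonal action. -/
def prod (X Y : FinGSet H) : FinGSet H where
  carrier := X.carrier × Y.carrier

/-- The one-point `H`-set. -/
def point (H : Type u) [Group H] : FinGSet H where
  carrier := PUnit

/-- The transitive `H`-set `H / L`. -/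
def coset [Finite H] (L : Subgroup H) : FinGSet H where
  carrier := H ⧸ L

theorem Iso.stabilizer_eq {X Y : FinGSet H} {e : X.carrier ≃ Y.carrier}
    (he : ∀ (h : H) (x : X.carrier), e (h • x) = h • e x) (x : X.carrier) :
    MulAction.stabilizer H (e x) = MulAction.stabilizer H x := by
  ext h
  rw [MulAction.mem_stabilizer_iff, MulAction.mem_stabilizer_iff, ← he, e.apply_eq_iff_eq]

theorem stabilizer_inl (X Y : FinGSet H) (x : X.carrier) :
    MulAction.stabilizer H (Sum.inl x : (X.sum Y).carrier) = MulAction.stabilizer H x := by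
  ext h
  exact Sum.inl_injective.eq_iff (a := h • x) (b := x)

theorem stabilizer_inr (X Y : FinGSet H) (y : Y.carrier) :
    MulAction.stabilizer H (Sum.inr y : (X.sum Y).carrier) = MulAction.stabilizer H y := by
  ext h
  exact Sum.inr_injective.eq_iff (a := h • y) (b := y)

/-- The complement of an orbit. -/
def orbitCompl (X : FinGSet H) (x : X.carrier) : FinGSet H where
  carrier := {y : X.carrier // y ∉ MulAction.orbit H x}
  action :=
    { smul := fun h y => ⟨h • y.1, fun hy => y.2 (by
        have := MulAction.mem_orbit_of_mem_orbit h⁻¹ hy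
        rwa [inv_smul_smul] at this)⟩
      one_smul := fun y => Subtype.ext (one_smul H y.1)
      mul_smul := fun g h y => Subtype.ext (mul_smul g h y.1) }

theorem iso_orbit_sum [Finite H] (X : FinGSet H) (x : X.carrier) :
    Iso ((coset (MulAction.stabilizer H x)).sum (X.orbitCompl x)) X := by
  let f : ((coset (MulAction.stabilizer H x)).sum (X.orbitCompl x)).carrier → X.carrier :=
    Sum.elim (MulAction.ofQuotientStabilizer H x) Subtype.val
  have hf : Function.Bijective f := by
    constructor
    · rintro (a | a) (b | b) hab
      · exact congrArg Sum.inl (MulAction.injective_ofQuotientStabilizer H x hab)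
      · exact absurd (Eq.subst (motive := (· ∈ MulAction.orbit H x)) hab
          (MulAction.ofQuotientStabilizer_mem_orbit H x a)) b.2
      · exact absurd (Eq.subst (motive := (· ∈ MulAction.orbit H x)) hab.symm
          (MulAction.ofQuotientStabilizer_mem_orbit H x b)) a.2
      · exact congrArg Sum.inr (Subtype.ext hab)
    · intro y
      by_cases hy : y ∈ MulAction.orbit H x
      · obtain ⟨h, rfl⟩ := hy
        exact ⟨Sum.inl (QuotientGroup.mk h), rfl⟩
      · exact ⟨Sum.inr ⟨y, hy⟩, rfl⟩
  refine ⟨Equiv.ofBijective f hf, ?_⟩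
  rintro h (a | a)
  · exact MulAction.ofQuotientStabilizer_smul H x h a
  · rfl

/-- Every finite `H`-set is a disjoint union of sets `H / L`; hence two functions on finite
`H`-sets that are invariant under isomorphism, additive on disjoint unions, and equal on the sets
`H / L`, are equal. -/
theorem additive_ext [Finite H] {V : Type*} [AddCommGroup V] {f g : FinGSet H → V}
    (fiso : ∀ X Y, Iso X Y → f X = f Y) (fsum : ∀ X Y, f (X.sum Y) = f X + f Y)
    (giso : ∀ X Y, Iso X Y → g X = g Y) (gsum : ∀ X Y, g (X.sum Y) = g X + g Y)
    (h : ∀ L, f (coset L) = g (coset L)) (X : FinGSet H) : f X = g X := by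
  induction hn : Nat.card X.carrier using Nat.strong_induction_on generalizing X with
  | _ n ih =>
    rcases isEmpty_or_nonempty X.carrier with hX | ⟨⟨x⟩⟩
    · have hi : Iso (X.sum X) X :=
        ⟨⟨Sum.elim id id, fun x => (hX.false x).elim, fun x => by
            rcases x with x | x <;> exact (hX.false x).elim, fun x => (hX.false x).elim⟩,
          fun _ x => by rcases x with x | x <;> exact (hX.false x).elim⟩
      have h₁ := fsum X X
      have h₂ := gsum X X
      rw [fiso _ _ hi] at h₁
      rw [giso _ _ hi] at h₂
      rw [left_eq_add.mp h₁, left_eq_add.mp h₂]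
    · have hi := X.iso_orbit_sum x
      have hlt : Nat.card (X.orbitCompl x).carrier < n := by
        rw [← hn]
        exact Finite.card_subtype_lt (x := x) (fun hx => hx (MulAction.mem_orbit_self x))
      rw [← fiso _ _ hi, ← giso _ _ hi, fsum, gsum, h, ih _ hlt _ rfl]

/-- The sum over the orbits of `X` of the values of `φ` at the stabilizer of a point of the orbit,
for a function `φ` on subgroups that is constant on conjugacy classes; the choice of points is
avoided by averaging over each orbit. -/
noncomputable def orbitSum {V : Type*} [AddCommGroup V] [Module ℚ V] (φ : Subgroup H → V)
    (X : FinGSet H) : V :=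
  ∑ᶠ x : X.carrier, ((Nat.card (MulAction.stabilizer H x) : ℚ) / Nat.card H) •
    φ (MulAction.stabilizer H x)

theorem orbitSum_iso {V : Type*} [AddCommGroup V] [Module ℚ V] (φ : Subgroup H → V)
    (X Y : FinGSet H) (h : Iso X Y) : orbitSum φ X = orbitSum φ Y := by
  obtain ⟨e, he⟩ := h
  rw [orbitSum, orbitSum, ← finsum_comp_equiv e]
  simp only [Iso.stabilizer_eq he]

theorem orbitSum_sum {V : Type*} [AddCommGroup V] [Module ℚ V] (φ : Subgroup H → V)
    (X Y : FinGSet H) : orbitSum φ (X.sum Y) = orbitSum φ X + orbitSum φ Y := by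
  let := Fintype.ofFinite X.carrier
  let := Fintype.ofFinite Y.carrier
  let : Fintype (X.sum Y).carrier := inferInstanceAs (Fintype (X.carrier ⊕ Y.carrier))
  rw [orbitSum, orbitSum, orbitSum, finsum_eq_sum_of_fintype, finsum_eq_sum_of_fintype,
    finsum_eq_sum_of_fintype]
  let F : Subgroup H → V := fun S => ((Nat.card S : ℚ) / Nat.card H) • φ S
  refine (Fintype.sum_sum_type _).trans (congrArg₂ _ ?_ ?_)
  · exact Finset.sum_congr rfl fun x _ => congrArg F (stabilizer_inl X Y x)
  · exact Finset.sum_congr rfl fun y _ => congrArg F (stabilizer_inr X Y y)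

theorem stabilizer_coset_mk [Finite H] (L : Subgroup H) (h : H) :
    MulAction.stabilizer H (QuotientGroup.mk h : (coset L).carrier) = conjSub h L := by
  have h₁ := MulAction.stabilizer_smul_eq_stabilizer_map_conj h ((1 : H) : H ⧸ L)
  rw [MulAction.stabilizer_quotient] at h₁
  rw [conjSub, ← h₁, MulAction.Quotient.smul_coe, smul_eq_mul, mul_one]

theorem stabilizer_coset [Finite H] (L : Subgroup H) (x : (coset L).carrier) :
    ∃ h : H, MulAction.stabilizer H x = conjSub h L := by
  obtain ⟨h, rfl⟩ := QuotientGroup.mk_surjective (s := L) x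
  exact ⟨h, stabilizer_coset_mk L h⟩

/-- The orbit sum on a transitive `H`-set is the value at the subgroup. -/
theorem orbitSum_coset [Finite H] {V : Type*} [AddCommGroup V] [Module ℚ V] (φ : Subgroup H → V)
    (hφ : ∀ (h : H) (L : Subgroup H), φ (conjSub h L) = φ L)
    (L : Subgroup H) : orbitSum φ (coset L) = φ L := by
  let : Fintype (coset L).carrier := Fintype.ofFinite _
  rw [orbitSum, finsum_eq_sum_of_fintype]
  have hterm : ∀ x : (coset L).carrier,
      ((Nat.card (MulAction.stabilizer H x) : ℚ) / Nat.card H) • φ (MulAction.stabilizer H x) =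
        ((Nat.card L : ℚ) / Nat.card H) • φ L := by
    intro x
    obtain ⟨h, hx⟩ := stabilizer_coset L x
    rw [hx, hφ, card_conjSub]
  rw [Finset.sum_congr rfl (fun x _ => hterm x), Finset.sum_const, Finset.card_univ,
    ← Nat.card_eq_fintype_card, ← Nat.cast_smul_eq_nsmul ℚ, smul_smul]
  have hc : (Nat.card (coset L).carrier : ℚ) * Nat.card L = Nat.card H := by
    have := L.card_eq_card_quotient_mul_card_subgroup
    exact_mod_cast this.symm
  rw [← mul_div_assoc, hc, div_self (by exact_mod_cast Nat.card_pos.ne'), one_smul]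

theorem Iso.prod {X X' Y Y' : FinGSet H} (h₁ : Iso X X') (h₂ : Iso Y Y') :
    Iso (X.prod Y) (X'.prod Y') := by
  obtain ⟨e, he⟩ := h₁
  obtain ⟨f, hf⟩ := h₂
  exact ⟨e.prodCongr f, fun h x => Prod.ext (he h x.1) (hf h x.2)⟩

theorem prod_sum_iso (Z X Y : FinGSet H) :
    Iso (Z.prod (X.sum Y)) ((Z.prod X).sum (Z.prod Y)) := by
  refine ⟨Equiv.prodSumDistrib _ _ _, ?_⟩
  rintro h ⟨z, x | y⟩ <;> rfl

end FinGSet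

/-- Isomorphism classes of finite `H`-sets. -/
def FinGSetClass (H : Type u) [Group H] : Type (u + 1) := Quotient (FinGSet.isoSetoid H)

/-- The isomorphism class of a finite `H`-set. -/
def FinGSetClass.mk {H : Type u} [Group H] (X : FinGSet H) : FinGSetClass H := Quotient.mk _ X

/-- Isomorphism classes of finite `H`-sets form a commutative monoid under cartesian product. -/
instance FinGSetClass.instCommMonoid (H : Type u) [Group H] : CommMonoid (FinGSetClass H) where
  mul := Quotient.map₂ FinGSet.prod (fun _ _ h₁ _ _ h₂ => FinGSet.Iso.prod h₁ h₂)
  one := FinGSetClass.mk (FinGSet.point H)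
  mul_assoc := by
    rintro ⟨X⟩ ⟨Y⟩ ⟨Z⟩
    exact Quotient.sound ⟨Equiv.prodAssoc _ _ _, fun _ _ => rfl⟩
  one_mul := by
    rintro ⟨X⟩
    exact Quotient.sound ⟨Equiv.punitProd _, fun _ _ => rfl⟩
  mul_one := by
    rintro ⟨X⟩
    exact Quotient.sound ⟨Equiv.prodPUnit _, fun _ _ => rfl⟩
  mul_comm := by
    rintro ⟨X⟩ ⟨Y⟩
    exact Quotient.sound ⟨Equiv.prodComm _ _, fun _ _ => rfl⟩

theorem FinGSetClass.mk_mul {H : Type u} [Group H] (X Y : FinGSet H) :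
    FinGSetClass.mk X * FinGSetClass.mk Y = FinGSetClass.mk (X.prod Y) := rfl

/-- The ideal of relations `[X ⊔ Y] = [X] + [Y]`. -/
noncomputable def burnsideIdeal (H : Type u) [Group H] :
    Ideal (MonoidAlgebra ℚ (FinGSetClass H)) :=
  Ideal.span {r | ∃ X Y : FinGSet H, r =
    MonoidAlgebra.of ℚ (FinGSetClass H) (FinGSetClass.mk (X.sum Y))
      - (MonoidAlgebra.of ℚ (FinGSetClass H) (FinGSetClass.mk X)
      + MonoidAlgebra.of ℚ (FinGSetClass H) (FinGSetClass.mk Y))}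

/-- The rational Burnside ring of `H`: the rational Grothendieck ring of finite `H`-sets, i.e. the
commutative `ℚ`-algebra generated by the classes `[X]` of finite `H`-sets, with addition given by
disjoint union and multiplication given by cartesian product. -/
abbrev RatBurnside (H : Type u) [Group H] : Type (u + 1) :=
  MonoidAlgebra ℚ (FinGSetClass H) ⧸ burnsideIdeal H

namespace RatBurnside

variable {H : Type u} [Group H]

/-- The class `[X]` of a finite `H`-set in the rational Burnside ring. -/
noncomputable def cls (X : FinGSet H) : RatBurnside H :=
  Ideal.Quotient.mk (burnsideIdeal H) (MonoidAlgebra.of ℚ (FinGSetClass H) (FinGSetClass.mk X))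

theorem cls_iso {X Y : FinGSet H} (h : FinGSet.Iso X Y) : cls X = cls Y := by
  have : FinGSetClass.mk X = FinGSetClass.mk Y := Quotient.sound h
  rw [cls, cls, this]

theorem cls_sum (X Y : FinGSet H) : cls (X.sum Y) = cls X + cls Y := by
  rw [cls, cls, cls, ← map_add]
  exact Ideal.Quotient.eq.mpr (Ideal.subset_span ⟨X, Y, rfl⟩)

theorem cls_prod (X Y : FinGSet H) : cls (X.prod Y) = cls X * cls Y := by
  rw [cls, cls, cls, ← map_mul, ← map_mul, FinGSetClass.mk_mul]

theorem mk_single (X : FinGSet H) (q : ℚ) :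
    Ideal.Quotient.mk (burnsideIdeal H) (MonoidAlgebra.single (FinGSetClass.mk X) q) =
      q • cls X := by
  have e : (MonoidAlgebra.single (FinGSetClass.mk X) q) =
      q • MonoidAlgebra.of ℚ (FinGSetClass H) (FinGSetClass.mk X) := by
    rw [MonoidAlgebra.of_apply, MonoidAlgebra.smul_single, smul_eq_mul, mul_one]
  rw [e, cls]
  rfl

/-- The rational Burnside ring is spanned by the classes of finite `H`-sets. -/
theorem induction_cls {p : RatBurnside H → Prop} (b : RatBurnside H) (zero : p 0)
    (add : ∀ a b, p a → p b → p (a + b)) (smul : ∀ (q : ℚ) X, p (q • cls X)) : p b := by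
  obtain ⟨a, rfl⟩ := Ideal.Quotient.mk_surjective b
  induction a using MonoidAlgebra.induction_linear with
  | zero => rw [map_zero]; exact zero
  | add f g hf hg => rw [map_add]; exact add _ _ hf hg
  | single x q =>
    obtain ⟨X, rfl⟩ : ∃ X, FinGSetClass.mk X = x := Quotient.exists_rep x
    rw [mk_single]
    exact smul q X

theorem hom_ext {V : Type*} [AddCommGroup V] [Module ℚ V] {S T : RatBurnside H →ₗ[ℚ] V}
    (h : ∀ X, S (cls X) = T (cls X)) : S = T := by
  refine LinearMap.ext fun b => ?_
  refine induction_cls (p := fun b => S b = T b) b ?_ ?_ ?_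
  · rw [map_zero, map_zero]
  · intro a b ha hb
    rw [map_add, map_add, ha, hb]
  · intro q X
    rw [map_smul, map_smul, h]

/-- Linear extension to the monoid algebra of an isomorphism invariant of finite `H`-sets. -/
noncomputable def preLift {V : Type*} [AddCommGroup V] [Module ℚ V] (f : FinGSet H → V)
    (hiso : ∀ X Y, FinGSet.Iso X Y → f X = f Y) :
    MonoidAlgebra ℚ (FinGSetClass H) →ₗ[ℚ] V :=
  (Finsupp.linearCombination ℚ (Quotient.lift f hiso : FinGSetClass H → V)) ∘ₗ
    (MonoidAlgebra.coeffLinearEquiv ℚ).toLinearMap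

theorem preLift_single {V : Type*} [AddCommGroup V] [Module ℚ V] (f : FinGSet H → V)
    (hiso : ∀ X Y, FinGSet.Iso X Y → f X = f Y) (X : FinGSet H) (q : ℚ) :
    preLift f hiso (MonoidAlgebra.single (FinGSetClass.mk X) q) = q • f X := by
  exact Finsupp.linearCombination_single ℚ q (FinGSetClass.mk X)

theorem preLift_eq_zero {V : Type*} [AddCommGroup V] [Module ℚ V] (f : FinGSet H → V)
    (hiso : ∀ X Y, FinGSet.Iso X Y → f X = f Y) (hsum : ∀ X Y, f (X.sum Y) = f X + f Y)
    (r : MonoidAlgebra ℚ (FinGSetClass H)) (hr : r ∈ burnsideIdeal H) :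
    preLift f hiso r = 0 := by
  suffices h : ∀ a, preLift f hiso (a * r) = 0 by simpa using h 1
  induction hr using Submodule.span_induction with
  | mem r hr =>
    obtain ⟨X, Y, rfl⟩ := hr
    intro a
    induction a using MonoidAlgebra.induction_linear with
    | zero => rw [zero_mul, map_zero]
    | add a b ha hb => rw [add_mul, map_add, ha, hb, add_zero]
    | single z q =>
      obtain ⟨Z, rfl⟩ : ∃ Z, FinGSetClass.mk Z = z := Quotient.exists_rep z
      simp only [MonoidAlgebra.of_apply, mul_sub, mul_add, MonoidAlgebra.single_mul_single,
        mul_one, FinGSetClass.mk_mul, map_sub, map_add, preLift_single]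
      rw [hiso _ _ (FinGSet.prod_sum_iso Z X Y), hsum, smul_add, sub_self]
  | zero => intro a; rw [mul_zero, map_zero]
  | add x y _ _ hx hy => intro a; rw [mul_add, map_add, hx, hy, add_zero]
  | smul c x _ hx => intro a; rw [smul_eq_mul, ← mul_assoc]; exact hx _

/-- Linear extension to the rational Burnside ring of a function on finite `H`-sets that is
invariant under isomorphism and additive on disjoint unions. -/
noncomputable def liftAdditive {V : Type*} [AddCommGroup V] [Module ℚ V] (f : FinGSet H → V)
    (hiso : ∀ X Y, FinGSet.Iso X Y → f X = f Y) (hsum : ∀ X Y, f (X.sum Y) = f X + f Y) :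
    RatBurnside H →ₗ[ℚ] V :=
  (((burnsideIdeal H).restrictScalars ℚ).liftQ (preLift f hiso)
    (fun r hr => preLift_eq_zero f hiso hsum r hr)) ∘ₗ
      (Submodule.Quotient.restrictScalarsEquiv ℚ (burnsideIdeal H)).symm.toLinearMap

theorem liftAdditive_cls {V : Type*} [AddCommGroup V] [Module ℚ V] (f : FinGSet H → V)
    (hiso : ∀ X Y, FinGSet.Iso X Y → f X = f Y) (hsum : ∀ X Y, f (X.sum Y) = f X + f Y)
    (X : FinGSet H) : liftAdditive f hiso hsum (cls X) = f X := by
  have h := preLift_single f hiso X 1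
  rw [one_smul] at h
  exact h

theorem hom_ext_coset [Finite H] {V : Type*} [AddCommGroup V] [Module ℚ V]
    {S T : RatBurnside H →ₗ[ℚ] V}
    (h : ∀ L, S (cls (FinGSet.coset L)) = T (cls (FinGSet.coset L))) : S = T :=
  hom_ext (FinGSet.additive_ext (f := fun X => S (cls X)) (g := fun X => T (cls X))
    (fun _ _ hi => by rw [cls_iso hi]) (fun _ _ => by rw [cls_sum, map_add])
    (fun _ _ hi => by rw [cls_iso hi]) (fun _ _ => by rw [cls_sum, map_add]) h)

/-- The `L`-component of tom Dieck's map, `[X] ↦ |X^L|`. -/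
noncomputable def mark (L : Subgroup H) : RatBurnside H →ₗ[ℚ] ℚ :=
  liftAdditive (fun X => (Nat.card {x : X.carrier // ∀ h ∈ L, h • x = x} : ℚ))
    (by
      rintro X Y ⟨e, he⟩
      refine congrArg Nat.cast (Nat.card_congr (e.subtypeEquiv fun x => ?_))
      simp only [← he, e.apply_eq_iff_eq])
    (by
      intro X Y
      rw [← Nat.cast_add, ← Nat.card_sum]
      refine congrArg Nat.cast (Nat.card_congr (Equiv.trans Equiv.subtypeSum
        (Equiv.sumCongr (Equiv.subtypeEquivRight fun x => ?_)
          (Equiv.subtypeEquivRight fun y => ?_))))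
      · exact forall₂_congr fun h _ => Sum.inl_injective.eq_iff (a := h • x) (b := x)
      · exact forall₂_congr fun h _ => Sum.inr_injective.eq_iff (a := h • y) (b := y))

theorem mark_cls (L : Subgroup H) (X : FinGSet H) :
    mark L (cls X) = Nat.card {x : X.carrier // ∀ h ∈ L, h • x = x} :=
  liftAdditive_cls _ _ _ X

/-- The number of points with stabilizer `L`. -/
noncomputable def stabCount (L : Subgroup H) : RatBurnside H →ₗ[ℚ] ℚ :=
  liftAdditive (fun X => (Nat.card {x : X.carrier // MulAction.stabilizer H x = L} : ℚ))
    (by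
      rintro X Y ⟨e, he⟩
      refine congrArg Nat.cast (Nat.card_congr (e.subtypeEquiv fun x => ?_))
      rw [FinGSet.Iso.stabilizer_eq he])
    (by
      intro X Y
      rw [← Nat.cast_add, ← Nat.card_sum]
      refine congrArg Nat.cast (Nat.card_congr (Equiv.trans Equiv.subtypeSum
        (Equiv.sumCongr (Equiv.subtypeEquivRight fun x => ?_)
          (Equiv.subtypeEquivRight fun y => ?_))))
      · exact iff_of_eq (congrArg (· = L) (FinGSet.stabilizer_inl X Y x))
      · exact iff_of_eq (congrArg (· = L) (FinGSet.stabilizer_inr X Y y)))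

theorem stabCount_cls (L : Subgroup H) (X : FinGSet H) :
    stabCount L (cls X) = Nat.card {x : X.carrier // MulAction.stabilizer H x = L} :=
  liftAdditive_cls _ _ _ X

open Classical in
theorem mark_eq_sum [Finite H] [Fintype (Subgroup H)] (L : Subgroup H) (b : RatBurnside H) :
    mark L b = ∑ L' : Subgroup H, if L ≤ L' then stabCount L' b else 0 := by
  have h : mark L = ∑ L' : Subgroup H, if L ≤ L' then stabCount L' else 0 := by
    refine hom_ext fun X => ?_
    let := Fintype.ofFinite X.carrier
    rw [mark_cls, LinearMap.sum_apply]
    simp only [apply_ite (fun T : RatBurnside H →ₗ[ℚ] ℚ => T (cls X)), stabCount_cls,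
      LinearMap.zero_apply, Nat.card_eq_fintype_card, Fintype.card_subtype]
    have hm : ∀ x : X.carrier, (∀ h ∈ L, h • x = x) ↔ L ≤ MulAction.stabilizer H x :=
      fun x => Iff.rfl
    simp only [hm]
    rw [Finset.card_eq_sum_card_fiberwise (f := fun x => MulAction.stabilizer H x)
      (t := Finset.univ) (fun _ _ => Finset.mem_univ _), Nat.cast_sum]
    refine Finset.sum_congr rfl fun L' _ => ?_
    split_ifs with hL
    · congr 2
      ext x
      simp only [Finset.mem_filter, Finset.mem_univ, true_and, and_iff_right_iff_imp]
      rintro rfl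
      exact hL
    · rw [Nat.cast_eq_zero, Finset.card_eq_zero, Finset.filter_eq_empty_iff]
      rintro x hx rfl
      exact hL (Finset.mem_filter.mp hx).2
  rw [h, LinearMap.sum_apply]
  refine Finset.sum_congr rfl fun L' _ => ?_
  split_ifs <;> rfl

theorem stabCount_eq_zero [Finite H] {b : RatBurnside H} (hb : ∀ L, mark L b = 0)
    (L : Subgroup H) : stabCount L b = 0 := by
  classical
  let := Fintype.ofFinite (Subgroup H)
  induction L using WellFoundedGT.induction with
  | ind L ih =>
    have h := mark_eq_sum L b
    rw [hb, Finset.sum_eq_single L, if_pos le_rfl] at h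
    · exact h.symm
    · intro L' _ hne
      split_ifs with hle
      · exact ih L' (lt_of_le_of_ne hle hne.symm)
      · rfl
    · intro h'
      exact absurd (Finset.mem_univ _) h'

theorem cls_coset_conj [Finite H] (h : H) (L : Subgroup H) :
    cls (FinGSet.coset (conjSub h L)) = cls (FinGSet.coset L) := by
  rw [← FinGSet.stabilizer_coset_mk]
  refine cls_iso ⟨Equiv.ofBijective (MulAction.ofQuotientStabilizer H
    (QuotientGroup.mk h : (FinGSet.coset L).carrier))
    ⟨MulAction.injective_ofQuotientStabilizer H _, fun y => ?_⟩,
    fun g x => MulAction.ofQuotientStabilizer_smul H _ g x⟩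
  obtain ⟨k, rfl⟩ := QuotientGroup.mk_surjective (s := L) y
  refine ⟨QuotientGroup.mk (k * h⁻¹), ?_⟩
  change (QuotientGroup.mk (k * h⁻¹ * h) : H ⧸ L) = QuotientGroup.mk k
  rw [inv_mul_cancel_right]

theorem eq_sum_stabCount [Finite H] [Fintype (Subgroup H)] (b : RatBurnside H) :
    b = ∑ L : Subgroup H, ((Nat.card L : ℚ) / Nat.card H * stabCount L b) •
      cls (FinGSet.coset L) := by
  classical
  have h : (LinearMap.id : RatBurnside H →ₗ[ℚ] RatBurnside H) = ∑ L : Subgroup H,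
      ((Nat.card L : ℚ) / Nat.card H) • (stabCount L).smulRight (cls (FinGSet.coset L)) := by
    refine hom_ext fun X => ?_
    let := Fintype.ofFinite X.carrier
    have hX := FinGSet.additive_ext (f := cls)
      (g := FinGSet.orbitSum fun L => cls (FinGSet.coset L)) (fun _ _ => cls_iso) cls_sum
      (FinGSet.orbitSum_iso _) (FinGSet.orbitSum_sum _)
      (fun L => (FinGSet.orbitSum_coset (fun L => cls (FinGSet.coset L)) cls_coset_conj L).symm) X
    rw [LinearMap.id_apply, LinearMap.sum_apply]
    refine hX.trans ?_
    rw [FinGSet.orbitSum, finsum_eq_sum_of_fintype,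
      ← Finset.sum_fiberwise Finset.univ (fun x : X.carrier => MulAction.stabilizer H x)]
    refine Finset.sum_congr rfl fun L _ => ?_
    rw [LinearMap.smul_apply, LinearMap.smulRight_apply, stabCount_cls, Nat.card_eq_fintype_card
      (α := {x : X.carrier // _}), Fintype.card_subtype, smul_comm, Nat.cast_smul_eq_nsmul,
      ← Finset.sum_const]
    refine Finset.sum_congr rfl fun x hx => ?_
    rw [(Finset.mem_filter.mp hx).2]
  have h' := LinearMap.congr_fun h b
  rw [LinearMap.id_apply, LinearMap.sum_apply] at h'
  refine h'.trans (Finset.sum_congr rfl fun L _ => ?_)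
  rw [LinearMap.smul_apply, LinearMap.smulRight_apply, smul_smul]

/-- Elements of the rational Burnside ring are determined by their marks. -/
theorem marks_injective [Finite H] {a b : RatBurnside H} (h : ∀ L, mark L a = mark L b) :
    a = b := by
  let := Fintype.ofFinite (Subgroup H)
  rw [← sub_eq_zero, eq_sum_stabCount (a - b)]
  refine Finset.sum_eq_zero fun L _ => ?_
  rw [stabCount_eq_zero (fun L => by rw [map_sub, h, sub_self]), mul_zero, zero_smul]

theorem mark_conjSub (h : H) (L : Subgroup H) (b : RatBurnside H) :
    mark (conjSub h L) b = mark L b := by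
  refine LinearMap.congr_fun (hom_ext fun X => ?_) b
  rw [mark_cls, mark_cls]
  refine congrArg Nat.cast (Nat.card_congr
    ((MulAction.toPerm h).subtypeEquiv fun x => ?_).symm)
  constructor
  · intro hx k hk
    have h₁ := hx _ (mem_conjSub.mp hk)
    have h₂ := congrArg (fun y => h • y) h₁
    simpa only [MulAction.toPerm_apply, smul_smul, mul_assoc, mul_inv_cancel_left] using h₂
  · intro hx k hk
    have h₁ := hx (h * k * h⁻¹) (mem_conjSub.mpr (by simpa [mul_assoc] using hk))
    rw [MulAction.toPerm_apply, smul_smul, inv_mul_cancel_right, mul_smul] at h₁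
    exact MulAction.injective h h₁

theorem le_of_mark_coset_ne_zero [Finite H] {K L : Subgroup H}
    (h : mark L (cls (FinGSet.coset K)) ≠ 0) : ∃ g : H, L ≤ conjSub g K := by
  rw [mark_cls, Nat.cast_ne_zero, Nat.card_ne_zero] at h
  obtain ⟨⟨x, hx⟩⟩ := h.1
  obtain ⟨g, hg⟩ := FinGSet.stabilizer_coset K x
  exact ⟨g, hg ▸ hx⟩

theorem mark_coset_self_ne_zero [Finite H] (K : Subgroup H) :
    mark K (cls (FinGSet.coset K)) ≠ 0 := by
  rw [mark_cls, Nat.cast_ne_zero, Nat.card_ne_zero]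
  refine ⟨⟨⟨QuotientGroup.mk 1, fun h hh => ?_⟩⟩, inferInstance⟩
  have h₁ := FinGSet.stabilizer_coset_mk K 1
  rw [conjSub_one] at h₁
  exact h₁.ge hh

/-- Every function on conjugacy classes of subgroups is the function of marks of an element of the
rational Burnside ring. -/
theorem exists_marks_eq [Finite H] (f : Subgroup H → ℚ)
    (hf : ∀ (h : H) (L : Subgroup H), f (conjSub h L) = f L) :
    ∃ e : RatBurnside H, ∀ L, mark L e = f L := by
  classical
  let := Fintype.ofFinite (Subgroup H)
  suffices hS : ∀ (n : ℕ) (S : Finset (Subgroup H)), S.card = n →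
      (∀ L ∈ S, ∀ (h : H) (L' : Subgroup H), L' ≤ conjSub h L → L' ∈ S) →
      ∀ f : Subgroup H → ℚ, (∀ (h : H) (L : Subgroup H), f (conjSub h L) = f L) →
      (∀ L, L ∉ S → f L = 0) → ∃ e : RatBurnside H, ∀ L, mark L e = f L from
    hS _ Finset.univ rfl (fun _ _ _ _ _ => Finset.mem_univ _) f hf
      (fun L hL => absurd (Finset.mem_univ L) hL)
  intro n
  induction n using Nat.strong_induction_on with
  | _ n ih =>
    intro S hn hclosed f hf hsupp
    rcases S.eq_empty_or_nonempty with rfl | hne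
    · exact ⟨0, fun L => by rw [map_zero, hsupp L (Finset.notMem_empty L)]⟩
    · obtain ⟨K, hK, hmax⟩ := S.exists_max_image (fun L => Nat.card L) hne
      let c : ℚ := f K / mark K (cls (FinGSet.coset K))
      let S' := S.filter fun L => ¬ ∃ h : H, L = conjSub h K
      have hlt : S'.card < n := by
        rw [← hn]
        refine Finset.card_lt_card (Finset.filter_ssubset.mpr ⟨K, hK, ?_⟩)
        exact not_not.mpr ⟨1, (conjSub_one K).symm⟩
      have hclosed' : ∀ L ∈ S', ∀ (h : H) (L' : Subgroup H), L' ≤ conjSub h L → L' ∈ S' := by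
        intro L hL h L' hL'
        obtain ⟨hLS, hLK⟩ := Finset.mem_filter.mp hL
        refine Finset.mem_filter.mpr ⟨hclosed L hLS h L' hL', ?_⟩
        rintro ⟨k, rfl⟩
        refine hLK ⟨h⁻¹ * k, ?_⟩
        have heq : conjSub k K = conjSub h L := by
          refine Subgroup.eq_of_le_of_card_ge hL' ?_
          rw [card_conjSub, card_conjSub]
          exact hmax L hLS
        rw [← conjSub_conjSub, heq, conjSub_conjSub, inv_mul_cancel, conjSub_one]
      have hsupp' : ∀ L, L ∉ S' → f L - c * mark L (cls (FinGSet.coset K)) = 0 := by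
        intro L hL
        by_cases hLS : L ∈ S
        · have : ∃ h : H, L = conjSub h K := by
            by_contra hcon
            exact hL (Finset.mem_filter.mpr ⟨hLS, hcon⟩)
          obtain ⟨h, rfl⟩ := this
          rw [hf, mark_conjSub, div_mul_cancel₀ _ (mark_coset_self_ne_zero K), sub_self]
        · have h₀ : mark L (cls (FinGSet.coset K)) = 0 := by
            by_contra hcon
            obtain ⟨g, hg⟩ := le_of_mark_coset_ne_zero hcon
            exact hLS (hclosed K hK g L hg)
          rw [hsupp L hLS, h₀, mul_zero, sub_zero]
      obtain ⟨e, he⟩ := ih _ hlt S' rfl hclosed'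
        (fun L => f L - c * mark L (cls (FinGSet.coset K)))
        (fun h L => by rw [hf, mark_conjSub]) hsupp'
      refine ⟨e + c • cls (FinGSet.coset K), fun L => ?_⟩
      rw [map_add, map_smul, he, smul_eq_mul, sub_add_cancel]

open Classical in
theorem exists_idem [Finite H] (K : Subgroup H) : ∃ e : RatBurnside H, ∀ L : Subgroup H,
    mark L e = if ∃ h : H, L = conjSub h K then 1 else 0 := by
  refine exists_marks_eq _ fun g L => if_congr ⟨?_, ?_⟩ rfl rfl
  · rintro ⟨h, hL⟩
    exact ⟨g⁻¹ * h, by rw [← conjSub_conjSub, ← hL, conjSub_conjSub, inv_mul_cancel, conjSub_one]⟩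
  · rintro ⟨h, rfl⟩
    exact ⟨g * h, conjSub_conjSub g h K⟩

/-- The idempotent `e_K^H` of the rational Burnside ring: the unique element with `|·^L| = 1` if
`L` is `H`-conjugate to `K` and `|·^L| = 0` otherwise. -/
noncomputable def idem [Finite H] (K : Subgroup H) : RatBurnside H := (exists_idem K).choose

open Classical in
theorem mark_idem [Finite H] (K L : Subgroup H) :
    mark L (idem K) = if ∃ h : H, L = conjSub h K then 1 else 0 :=
  (exists_idem K).choose_spec L

open Classical in
theorem idem_unique [Finite H] (K : Subgroup H) (b : RatBurnside H)
    (hb : ∀ L, mark L b = if ∃ h : H, L = conjSub h K then 1 else 0) : b = idem K :=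
  marks_injective fun L => by rw [hb, mark_idem]

end RatBurnside

/-! ### Rational Mackey functors -/

theorem inf_conjSub_eq {G : Type*} [Group G] (x : G) (K L : Subgroup G) :
    K ⊓ conjSub x L = conjSub x (L ⊓ conjSub x⁻¹ K) := by
  ext y
  simp only [Subgroup.mem_inf, mem_conjSub]
  constructor
  · rintro ⟨h₁, h₂⟩
    exact ⟨h₂, by simpa [mul_assoc] using h₁⟩
  · rintro ⟨h₁, h₂⟩
    exact ⟨by simpa [mul_assoc] using h₂, h₁⟩

/-- A rational `G`-Mackey functor. The value `M(G/H)` is `M.val H`; restriction `R^H_K`, induction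
`I^H_K` and conjugation `C_g : M(G/H) → M(G/gHg⁻¹)` are `M.res`, `M.ind` and `M.conj`. The target of
`C_g` is written as a subgroup `L` with a proof of `L = gHg⁻¹`. -/
structure RatMackeyFunctor (G : Type u) [Group G] [Finite G] where
  val : Subgroup G → Type v
  [addCommGroup : ∀ H, AddCommGroup (val H)]
  [module : ∀ H, Module ℚ (val H)]
  res : ∀ {K H : Subgroup G}, K ≤ H → (val H →ₗ[ℚ] val K)
  ind : ∀ {K H : Subgroup G}, K ≤ H → (val K →ₗ[ℚ] val H)
  conj : ∀ (g : G) {H L : Subgroup G}, L = conjSub g H → (val H →ₗ[ℚ] val L)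
  res_self : ∀ H : Subgroup G, res (le_refl H) = LinearMap.id
  ind_self : ∀ H : Subgroup G, ind (le_refl H) = LinearMap.id
  conj_self : ∀ (H : Subgroup G) (h : G) (hh : h ∈ H), conj h (conjSub_self hh) = LinearMap.id
  ind_trans : ∀ {L K H : Subgroup G} (hLK : L ≤ K) (hKH : K ≤ H),
    ind (hLK.trans hKH) = ind hKH ∘ₗ ind hLK
  res_trans : ∀ {L K H : Subgroup G} (hLK : L ≤ K) (hKH : K ≤ H),
    res (hLK.trans hKH) = res hLK ∘ₗ res hKH
  conj_mul : ∀ (g h : G) (H : Subgroup G),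
    conj (g * h) (conjSub_conjSub g h H) = conj g rfl ∘ₗ conj h rfl
  res_conj : ∀ (g : G) {K H : Subgroup G} (hKH : K ≤ H),
    res (conjSub_mono g hKH) ∘ₗ conj g rfl = conj g rfl ∘ₗ res hKH
  ind_conj : ∀ (g : G) {K H : Subgroup G} (hKH : K ≤ H),
    ind (conjSub_mono g hKH) ∘ₗ conj g rfl = conj g rfl ∘ₗ ind hKH
  /-- The Mackey axiom; the sum runs over representatives `x ∈ H` of the double cosets
  `K x L` in `H`. -/
  mackey : ∀ {K L H : Subgroup G} (hKH : K ≤ H) (hLH : L ≤ H),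
    res hKH ∘ₗ ind hLH =
      ∑ᶠ q : DoubleCoset.Quotient (K.subgroupOf H : Set H) (L.subgroupOf H : Set H),
        let x : G := ((Quotient.out q : H) : G)
        ind (inf_le_left : K ⊓ conjSub x L ≤ K) ∘ₗ
          conj x (inf_conjSub_eq x K L) ∘ₗ
            res (inf_le_left : L ⊓ conjSub x⁻¹ K ≤ L)

attribute [instance] RatMackeyFunctor.addCommGroup RatMackeyFunctor.module

namespace RatMackeyFunctor

section Weyl

variable {G : Type u} [Group G]

/-- The normalizer `N_H K`. -/
abbrev normIn (K H : Subgroup G) : Subgroup H := Subgroup.normalizer (K.subgroupOf H : Set H)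

/-- The Weyl group `W_H K = N_H K / K`. -/
abbrev Weyl (K H : Subgroup G) : Type u := normIn K H ⧸ (K.subgroupOf H).subgroupOf (normIn K H)

theorem eq_conjSub_of_mem_norm {K H : Subgroup G} (hKH : K ≤ H) (n : normIn K H) :
    K = conjSub ((n : H) : G) K := by
  have h := Subgroup.mem_normalizer_iff_map_conj_eq.mp n.2
  have h₁ : (conjSub (n : H) (K.subgroupOf H)).map H.subtype = K :=
    (congrArg (Subgroup.map H.subtype) h).trans (Subgroup.map_subgroupOf_eq_of_le hKH)
  have h₂ : (conjSub (n : H) (K.subgroupOf H)).map H.subtype =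
      conjSub ((n : H) : G) ((K.subgroupOf H).map H.subtype) := by
    rw [conjSub, conjSub, Subgroup.map_map, Subgroup.map_map]
    rfl
  rw [Subgroup.map_subgroupOf_eq_of_le hKH] at h₂
  exact h₁.symm.trans h₂

end Weyl

variable {G : Type u} [Group G] [Finite G] (M : RatMackeyFunctor.{u, v} G)

theorem conj_comp (g h : G) {H L N : Subgroup G} (hL : L = conjSub h H) (hN : N = conjSub g L)
    (hN' : N = conjSub (g * h) H) : M.conj (g * h) hN' = M.conj g hN ∘ₗ M.conj h hL := by
  subst hL
  subst hN
  exact M.conj_mul g h H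

/-- The operator `I^H_L ∘ R^H_L` on `M(G/H)`, for `L` a subgroup of `H`. -/
def indRes (H : Subgroup G) (L : Subgroup H) : Module.End ℚ (M.val H) :=
  M.ind (Subgroup.map_subtype_le L) ∘ₗ M.res (Subgroup.map_subtype_le L)

theorem res_comp_conj (g : G) {K H K' H' : Subgroup G} (hK : K' = conjSub g K)
    (hH : H' = conjSub g H) (hKH : K ≤ H) (hKH' : K' ≤ H') :
    M.res hKH' ∘ₗ M.conj g hH = M.conj g hK ∘ₗ M.res hKH := by
  subst hK
  subst hH
  exact M.res_conj g hKH

theorem ind_comp_conj (g : G) {K H K' H' : Subgroup G} (hK : K' = conjSub g K)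
    (hH : H' = conjSub g H) (hKH : K ≤ H) (hKH' : K' ≤ H') :
    M.ind hKH' ∘ₗ M.conj g hK = M.conj g hH ∘ₗ M.ind hKH := by
  subst hK
  subst hH
  exact M.ind_conj g hKH

/-- The operator `I^H_L ∘ R^H_L` only depends on the `H`-conjugacy class of `L`. -/
theorem indRes_conjSub (H : Subgroup G) (h : H) (L : Subgroup H) :
    M.indRes H (conjSub h L) = M.indRes H L := by
  have hL : (conjSub h L).map H.subtype = conjSub (h : G) (L.map H.subtype) := by
    rw [conjSub, conjSub, Subgroup.map_map, Subgroup.map_map]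
    rfl
  have h₁ := M.res_comp_conj (h : G) hL (conjSub_self h.2) (Subgroup.map_subtype_le L)
    (Subgroup.map_subtype_le _)
  have h₂ := M.ind_comp_conj (h : G) hL (conjSub_self h.2) (Subgroup.map_subtype_le L)
    (Subgroup.map_subtype_le _)
  rw [M.conj_self H h h.2, LinearMap.comp_id] at h₁
  rw [M.conj_self H h h.2, LinearMap.id_comp] at h₂
  rw [indRes, indRes, h₁, ← LinearMap.comp_assoc, h₂]

/-- The action of the rational Burnside ring `A_ℚ(H)` on `M(G/H)`: the linear map with
`[H/L] ↦ I^H_L ∘ R^H_L`, see `burnsideAct_coset` and `RatBurnside.hom_ext_coset`. -/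
noncomputable def burnsideAct (H : Subgroup G) : RatBurnside H →ₗ[ℚ] Module.End ℚ (M.val H) :=
  RatBurnside.liftAdditive (FinGSet.orbitSum (M.indRes H))
    (FinGSet.orbitSum_iso _) (FinGSet.orbitSum_sum _)

theorem burnsideAct_coset (H : Subgroup G) (L : Subgroup H) :
    M.burnsideAct H (RatBurnside.cls (FinGSet.coset L)) = M.indRes H L := by
  rw [burnsideAct, RatBurnside.liftAdditive_cls]
  exact FinGSet.orbitSum_coset _ (M.indRes_conjSub H) L

/-- The summand `e_K^H M(G/H)` of `M(G/H)`, for `K ≤ H`. -/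
noncomputable def idemPart {K H : Subgroup G} (_hKH : K ≤ H) : Submodule ℚ (M.val H) :=
  LinearMap.range (M.burnsideAct H (RatBurnside.idem (K.subgroupOf H)))

/-- The action of `W_H K` on `M(G/K)` by conjugation maps. -/
noncomputable def weylRep {K H : Subgroup G} (hKH : K ≤ H) :
    Representation ℚ (Weyl K H) (M.val K) :=
  QuotientGroup.lift _
    { toFun := fun n => M.conj ((n : H) : G) (eq_conjSub_of_mem_norm hKH n)
      map_one' := M.conj_self K 1 K.one_mem
      map_mul' := fun n m => M.conj_comp _ _ _ _ _ }
    (by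
      intro n hn
      exact M.conj_self K _ hn)

/-- The fixed points `(e_K^K M(G/K))^{W_H K}`: the elements of `e_K^K M(G/K)` that are fixed by the
action of `W_H K` on `M(G/K)`. -/
noncomputable def idemFixed {K H : Subgroup G} (hKH : K ≤ H) : Submodule ℚ (M.val K) :=
  M.idemPart (le_refl K) ⊓ (M.weylRep hKH).invariants

end RatMackeyFunctor

/-!
On `e_K^H M(G/H)` and `(e_K^K M(G/K))^{W_H K}` the maps `R^H_K` and `I^H_K` are mutually inverse up
to the nonzero scalar `|(H/K)^K| = |W_H K|`. For `I^H_K ∘ R^H_K`, which is the action of `[H/K]`,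
this holds because `b * e_K^H = |b^K| • e_K^H` in the Burnside ring and the action is
multiplicative. For `R^H_K ∘ I^H_K`, restriction to a proper subgroup kills `e_K^K M(G/K)`, so in
the Mackey formula only the double cosets `KxK` with `x` in the normalizer of `K` contribute, and
each of them fixes a Weyl-invariant element.

Both multiplicativity and compatibility with restriction reduce to counting orbits: the action of
`[X]` is a sum over the orbits of `X`, and the orbits of `H/K × X` under `H` correspond to those of
`X` under `K`, while the orbits of `H/L` under `K` are the double cosets of the Mackey formula.
-/

theorem map_conjSub {G G' : Type*} [Group G] [Group G'] (f : G →* G') (g : G) (S : Subgroup G) :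
    (conjSub g S).map f = conjSub (f g) (S.map f) := by
  rw [conjSub, conjSub, Subgroup.map_map, Subgroup.map_map]
  congr 1
  ext x
  simp

theorem conjSub_subgroupOf {G : Type*} [Group G] {H : Subgroup G} (h : H) (L : Subgroup G) :
    conjSub h (L.subgroupOf H) = (conjSub (h : G) L).subgroupOf H := by
  ext x
  simp [mem_conjSub, Subgroup.mem_subgroupOf]

theorem conjSub_eq_top_iff {G : Type*} [Group G] {g : G} {S : Subgroup G} :
    conjSub g S = ⊤ ↔ S = ⊤ := by
  simp only [Subgroup.eq_top_iff', mem_conjSub]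
  exact ⟨fun h x => by simpa [mul_assoc] using h (g * x * g⁻¹), fun h x => h _⟩

theorem le_conjSub_iff_eq {G : Type*} [Group G] {g : G} {K : Subgroup G} [Finite K] :
    K ≤ conjSub g K ↔ K = conjSub g K := by
  have : Finite (conjSub g K) := (Set.toFinite (K : Set G)).image (MulAut.conj g)
  exact ⟨fun h => Subgroup.eq_of_le_of_card_ge h (card_conjSub g K).le, le_of_eq⟩

theorem eq_conjSub_inv_iff {G : Type*} [Group G] {g : G} {K : Subgroup G} :
    K = conjSub g⁻¹ K ↔ K = conjSub g K := by
  suffices h : ∀ {g : G}, K = conjSub g K → K = conjSub g⁻¹ K from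
    ⟨fun hg => inv_inv g ▸ h hg, h⟩
  intro g hg
  conv_rhs => rw [hg, conjSub_conjSub, inv_mul_cancel, conjSub_one]

theorem exists_eq_subgroupOf {G : Type*} [Group G] {H : Subgroup G} (S : Subgroup H) :
    ∃ L ≤ H, S = L.subgroupOf H :=
  ⟨S.map H.subtype, Subgroup.map_subtype_le S,
    (Subgroup.comap_map_eq_self_of_injective H.subtype_injective S).symm⟩

namespace FinGSet

variable {H K : Type u} [Group H] [Group K] {V W : Type*} [AddCommGroup V] [Module ℚ V]
  [AddCommGroup W] [Module ℚ W]

/-- The `K`-set obtained by restricting an `H`-set along a homomorphism `K → H`. -/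
def restrict (f : K →* H) (X : FinGSet H) : FinGSet K where
  carrier := X.carrier
  action := MulAction.compHom _ f

theorem Iso.restrict (f : K →* H) {X Y : FinGSet H} (h : Iso X Y) :
    Iso (X.restrict f) (Y.restrict f) := by
  obtain ⟨e, he⟩ := h
  exact ⟨e, fun k x => he (f k) x⟩

theorem restrict_sum_iso (f : K →* H) (X Y : FinGSet H) :
    Iso ((X.sum Y).restrict f) ((X.restrict f).sum (Y.restrict f)) := by
  refine ⟨Equiv.refl _, ?_⟩
  rintro k (x | y) <;> rfl

theorem stabilizer_restrict (f : K →* H) (X : FinGSet H) (x : X.carrier) :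
    MulAction.stabilizer K (α := (X.restrict f).carrier) x = (MulAction.stabilizer H x).comap f :=
  rfl

theorem stabilizer_prod (X Y : FinGSet H) (x : X.carrier) (y : Y.carrier) :
    MulAction.stabilizer H ((x, y) : (X.prod Y).carrier) =
      MulAction.stabilizer H x ⊓ MulAction.stabilizer H y := by
  ext h
  exact Prod.ext_iff (x := ((h • x, h • y) : X.carrier × Y.carrier)) (y := (x, y))

theorem map_orbitSum (T : V →ₗ[ℚ] W) (φ : Subgroup H → V) (X : FinGSet H) :
    T (orbitSum φ X) = orbitSum (fun S => T (φ S)) X := by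
  rw [orbitSum, orbitSum, map_finsum T (Set.toFinite _)]
  simp only [map_smul]

/-- A family of points of an `H`-set meeting every orbit exactly once: a system of orbit
representatives, indexed by an arbitrary type so that double cosets can serve as indices. -/
structure IsOrbitTransversal (X : FinGSet H) {Q : Type*} (r : Q → X.carrier) : Prop where
  eq_of_smul_eq : ∀ {h : H} {q q' : Q}, h • r q = r q' → q = q'
  exists_smul_eq : ∀ x : X.carrier, ∃ (q : Q) (h : H), h • r q = x

theorem isOrbitTransversal_out (X : FinGSet H) :
    X.IsOrbitTransversal (Quotient.out : MulAction.orbitRel.Quotient H X.carrier → X.carrier) where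
  eq_of_smul_eq {h q q'} hq := by
    rw [← q.out_eq', ← q'.out_eq']
    exact (Quotient.sound (s := MulAction.orbitRel H X.carrier) ⟨h, hq⟩).symm
  exists_smul_eq x :=
    ⟨_, MulAction.mem_orbit_symm.mp (Quotient.mk_out (s := MulAction.orbitRel H X.carrier) x)⟩

namespace IsOrbitTransversal

variable {X : FinGSet H} {Q : Type*} {r : Q → X.carrier}

theorem finite (hr : X.IsOrbitTransversal r) : Finite Q :=
  Finite.of_injective r fun q q' h => hr.eq_of_smul_eq (h := 1) (by rw [one_smul, h])

theorem bijective_ofQuotientStabilizer (hr : X.IsOrbitTransversal r) :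
    Function.Bijective fun p : Σ q, H ⧸ MulAction.stabilizer H (r q) =>
      MulAction.ofQuotientStabilizer H (r p.1) p.2 := by
  constructor
  · rintro ⟨q, ⟨g⟩⟩ ⟨q', ⟨g'⟩⟩ (h : g • r q = g' • r q')
    obtain rfl : q = q' := hr.eq_of_smul_eq (h := g'⁻¹ * g) (by rw [mul_smul, h, inv_smul_smul])
    exact congrArg (Sigma.mk q) (MulAction.injective_ofQuotientStabilizer H (r q) h)
  · intro x
    obtain ⟨q, h, rfl⟩ := hr.exists_smul_eq x
    exact ⟨⟨q, QuotientGroup.mk h⟩, rfl⟩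

theorem orbitSum_eq_finsum [Finite H] (hr : X.IsOrbitTransversal r) {φ : Subgroup H → V}
    (hφ : ∀ (h : H) (L : Subgroup H), φ (conjSub h L) = φ L) :
    orbitSum φ X = ∑ᶠ q, φ (MulAction.stabilizer H (r q)) := by
  have := hr.finite
  let := Fintype.ofFinite Q
  let := Fintype.ofFinite X.carrier
  let (q : Q) : Fintype (H ⧸ MulAction.stabilizer H (r q)) := Fintype.ofFinite _
  have stabilizer_eq (q : Q) (c : H ⧸ MulAction.stabilizer H (r q)) :
      MulAction.stabilizer H (MulAction.ofQuotientStabilizer H (r q) c) =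
        MulAction.stabilizer H c := by
    ext h
    rw [MulAction.mem_stabilizer_iff, MulAction.mem_stabilizer_iff,
      ← MulAction.ofQuotientStabilizer_smul]
    exact (MulAction.injective_ofQuotientStabilizer H (r q)).eq_iff
  rw [orbitSum, finsum_eq_sum_of_fintype, finsum_eq_sum_of_fintype,
    ← Function.Bijective.sum_comp hr.bijective_ofQuotientStabilizer, Fintype.sum_sigma]
  refine Finset.sum_congr rfl fun q _ => ?_
  let weighted (S : Subgroup H) : V := ((Nat.card S : ℚ) / Nat.card H) • φ S
  rw [← orbitSum_coset φ hφ (MulAction.stabilizer H (r q))]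
  exact (Finset.sum_congr rfl fun c _ => congrArg weighted (stabilizer_eq q c)).trans
    (finsum_eq_sum_of_fintype _).symm

theorem coset_range_prod [Finite H] {f : K →* H} {r : Q → (X.restrict f).carrier}
    (hr : (X.restrict f).IsOrbitTransversal r) :
    ((coset f.range).prod X).IsOrbitTransversal
      fun q => ((QuotientGroup.mk 1 : H ⧸ f.range), r q) where
  eq_of_smul_eq {h q q'} hq := by
    have hh : h ∈ f.range := by
      have := QuotientGroup.eq.mp (congrArg Prod.fst hq).symm
      simpa using this
    obtain ⟨k, rfl⟩ := hh
    exact hr.eq_of_smul_eq (h := k) (congrArg Prod.snd hq)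
  exists_smul_eq := by
    rintro ⟨⟨g⟩, x⟩
    obtain ⟨q, k, hk⟩ := hr.exists_smul_eq (g⁻¹ • x : X.carrier)
    refine ⟨q, g * f k, Prod.ext ?_ ?_⟩
    · exact QuotientGroup.eq.mpr (by simp)
    · exact (mul_smul g (f k) _).trans (smul_eq_iff_eq_inv_smul g |>.mpr hk)

end IsOrbitTransversal

/-- `H/f(K) × X` is the `H`-set induced from the restriction of `X` to `K`. -/
theorem orbitSum_coset_range_prod [Finite H] [Finite K] (f : K →* H) {φ : Subgroup H → V}
    (hφ : ∀ (h : H) (L : Subgroup H), φ (conjSub h L) = φ L) (X : FinGSet H) :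
    orbitSum φ ((coset f.range).prod X) = orbitSum (fun S => φ (S.map f)) (X.restrict f) := by
  have hφf (k : K) (S : Subgroup K) : φ ((conjSub k S).map f) = φ (S.map f) := by
    rw [map_conjSub, hφ]
  have hr := isOrbitTransversal_out (X.restrict f)
  rw [hr.coset_range_prod.orbitSum_eq_finsum hφ, hr.orbitSum_eq_finsum hφf]
  refine finsum_congr fun q => congrArg φ ?_
  have stabilizer_one := (stabilizer_coset_mk f.range 1).trans (conjSub_one _)
  exact (stabilizer_prod (coset f.range) X _ _).trans
    ((congrArg (· ⊓ _) stabilizer_one).trans (Subgroup.map_comap_eq f _).symm)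

theorem isOrbitTransversal_doubleCoset [Finite H] (f : K →* H) (L : Subgroup H) :
    ((coset L).restrict f).IsOrbitTransversal
      fun q : DoubleCoset.Quotient (f.range : Set H) (L : Set H) =>
        (QuotientGroup.mk q.out : H ⧸ L) where
  eq_of_smul_eq {k q q'} hq := by
    have hl : (f k * q.out)⁻¹ * q'.out ∈ L := QuotientGroup.eq.mp hq
    rw [← DoubleCoset.out_eq' _ _ q, ← DoubleCoset.out_eq' _ _ q', DoubleCoset.eq]
    exact ⟨f k, ⟨k, rfl⟩, _, hl, (mul_inv_cancel_left _ _).symm⟩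
  exists_smul_eq := by
    rintro ⟨h⟩
    obtain ⟨_, l, ⟨k, rfl⟩, hl, hout⟩ := DoubleCoset.mk_out_eq_mul f.range L h
    refine ⟨DoubleCoset.mk f.range L h, k⁻¹, QuotientGroup.eq.mpr ?_⟩
    change (f k⁻¹ * (DoubleCoset.mk f.range L h).out)⁻¹ * h ∈ L
    rw [hout]
    simpa [mul_assoc] using hl

theorem orbitSum_restrict_coset [Finite H] [Finite K] (f : K →* H) {φ : Subgroup K → V}
    (hφ : ∀ (k : K) (S : Subgroup K), φ (conjSub k S) = φ S) (L : Subgroup H) :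
    orbitSum φ ((coset L).restrict f) =
      ∑ᶠ q : DoubleCoset.Quotient (f.range : Set H) (L : Set H),
        φ ((conjSub q.out L).comap f) := by
  rw [(isOrbitTransversal_doubleCoset f L).orbitSum_eq_finsum hφ]
  refine finsum_congr fun q => congrArg φ ?_
  exact (stabilizer_restrict f (coset L) _).trans (congrArg _ (stabilizer_coset_mk L q.out))

theorem orbitSum_restrict_inclusion_coset {G : Type u} [Group G] [Finite G] {K H : Subgroup G}
    (hKH : K ≤ H) {φ : Subgroup K → V} (hφ : ∀ (k : K) (S : Subgroup K), φ (conjSub k S) = φ S)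
    (L : Subgroup G) :
    orbitSum φ ((coset (L.subgroupOf H)).restrict (Subgroup.inclusion hKH)) =
      ∑ᶠ q : DoubleCoset.Quotient (K.subgroupOf H : Set H) (L.subgroupOf H : Set H),
        φ ((conjSub (q.out : G) L).subgroupOf K) := by
  have h := orbitSum_restrict_coset (Subgroup.inclusion hKH) hφ (L.subgroupOf H)
  simp only [conjSub_subgroupOf, Subgroup.comap_inclusion_subgroupOf] at h
  rwa [Subgroup.inclusion_range] at h

open Classical in
theorem orbitSum_ite_eq_top [Finite H] (v : V) (X : FinGSet H) :
    orbitSum (fun S => if S = ⊤ then v else 0) X = RatBurnside.mark ⊤ (RatBurnside.cls X) • v := by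
  let := Fintype.ofFinite X.carrier
  have hterm (x : X.carrier) : ((Nat.card (MulAction.stabilizer H x) : ℚ) / Nat.card H) •
      (if MulAction.stabilizer H x = ⊤ then v else 0) =
        if ∀ h ∈ (⊤ : Subgroup H), h • x = x then v else 0 := by
    have hfixed : MulAction.stabilizer H x = ⊤ ↔ ∀ h ∈ (⊤ : Subgroup H), h • x = x :=
      top_le_iff.symm
    rw [← hfixed]
    split_ifs with hx
    · rw [hx, Subgroup.card_top, div_self (Nat.cast_ne_zero.mpr Nat.card_pos.ne'), one_smul]
    · rw [smul_zero]
  rw [orbitSum, finsum_eq_sum_of_fintype, Finset.sum_congr rfl fun x _ => hterm x,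
    ← Finset.sum_filter, Finset.sum_const, RatBurnside.mark_cls, Nat.card_eq_fintype_card,
    Fintype.card_subtype, Nat.cast_smul_eq_nsmul]

end FinGSet

namespace RatBurnside

variable {H K : Type u} [Group H] [Group K]

/-- The linear map of Burnside rings induced by restricting finite `H`-sets along a homomorphism
`K → H`. -/
noncomputable def restrict (f : K →* H) : RatBurnside H →ₗ[ℚ] RatBurnside K :=
  liftAdditive (fun X => cls (X.restrict f)) (fun _ _ h => cls_iso (h.restrict f))
    fun X Y => by rw [cls_iso (X.restrict_sum_iso f Y), cls_sum]

theorem restrict_cls (f : K →* H) (X : FinGSet H) : restrict f (cls X) = cls (X.restrict f) :=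
  liftAdditive_cls _ _ _ X

theorem mark_restrict (f : K →* H) (L : Subgroup K) (b : RatBurnside H) :
    mark L (restrict f b) = mark (L.map f) b := by
  suffices h : mark L ∘ₗ restrict f = mark (L.map f) from LinearMap.congr_fun h b
  refine hom_ext fun X => ?_
  rw [LinearMap.comp_apply, restrict_cls, mark_cls, mark_cls]
  refine congrArg Nat.cast (Nat.card_congr (Equiv.subtypeEquivRight fun x => ?_))
  exact (Subgroup.map_le_iff_le_comap (H := MulAction.stabilizer H (α := X.carrier) x)).symm

theorem mark_mul (L : Subgroup H) (a b : RatBurnside H) :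
    mark L (a * b) = mark L a * mark L b := by
  suffices h : (LinearMap.mul ℚ (RatBurnside H)).compr₂ (mark L) =
      (LinearMap.mul ℚ ℚ).compl₁₂ (mark L) (mark L) from LinearMap.congr_fun₂ h a b
  refine hom_ext fun X => hom_ext fun Y => ?_
  simp only [LinearMap.compr₂_apply, LinearMap.compl₁₂_apply, LinearMap.mul_apply', ← cls_prod,
    mark_cls]
  rw [← Nat.cast_mul, ← Nat.card_prod]
  refine congrArg Nat.cast (Nat.card_congr (Equiv.trans (Equiv.subtypeEquivRight fun p => ?_)
    (Equiv.subtypeProdEquivProd)))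
  exact ⟨fun h => ⟨fun k hk => congrArg Prod.fst (h k hk), fun k hk => congrArg Prod.snd (h k hk)⟩,
    fun h k hk => Prod.ext (h.1 k hk) (h.2 k hk)⟩

section Idempotents

variable [Finite H]

theorem mark_idem_self (K : Subgroup H) : mark K (idem K) = 1 := by
  rw [mark_idem, if_pos ⟨1, (conjSub_one K).symm⟩]

theorem mark_idem_of_card_ne {K L : Subgroup H} (h : Nat.card L ≠ Nat.card K) :
    mark L (idem K) = 0 := by
  rw [mark_idem, if_neg]
  rintro ⟨g, rfl⟩
  exact h (card_conjSub g K)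

theorem mul_idem (b : RatBurnside H) (K : Subgroup H) : b * idem K = mark K b • idem K := by
  refine marks_injective fun L => ?_
  rw [mark_mul, map_smul, smul_eq_mul, mark_idem]
  split_ifs with h
  · obtain ⟨g, rfl⟩ := h
    rw [mark_conjSub]
  · rw [mul_zero, mul_zero]

variable [Finite K] {f : K →* H}

theorem restrict_idem_range (hf : Function.Injective f) :
    restrict f (idem f.range) = idem (⊤ : Subgroup K) := by
  refine marks_injective fun L => ?_
  rw [mark_restrict]
  by_cases hL : L = ⊤
  · rw [hL, ← MonoidHom.range_eq_map, mark_idem_self, mark_idem_self]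
  · have card_lt : Nat.card L < Nat.card (⊤ : Subgroup K) := by
      rw [Subgroup.card_top]
      exact lt_of_le_of_ne L.card_le_card_group fun h => hL (L.eq_top_of_card_eq h)
    rw [mark_idem_of_card_ne card_lt.ne, mark_idem_of_card_ne]
    rw [MonoidHom.range_eq_map, Subgroup.card_map_of_injective hf,
      Subgroup.card_map_of_injective hf]
    exact card_lt.ne

theorem restrict_idem_of_card_lt {L : Subgroup H} (h : Nat.card K < Nat.card L) :
    restrict f (idem L) = 0 := by
  refine marks_injective fun S => ?_
  rw [mark_restrict, map_zero]
  have card_map_le : Nat.card (S.map f) ≤ Nat.card K :=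
    Nat.le_of_dvd Nat.card_pos ((S.card_map_dvd f).trans S.card_subgroup_dvd_card)
  exact mark_idem_of_card_ne (card_map_le.trans_lt h).ne

end Idempotents

end RatBurnside

namespace RatMackeyFunctor

open RatBurnside

variable {G : Type u} [Group G] [Finite G] (M : RatMackeyFunctor.{u, v} G)

theorem indRes_apply {H L : Subgroup G} {S : Subgroup H} (hS : L = S.map H.subtype) (hLH : L ≤ H)
    (x : M.val H) : M.indRes H S x = M.ind hLH (M.res hLH x) := by
  subst hS
  rfl

theorem conj_res_of_mem {H L L' : Subgroup G} {g : G} (hg : g ∈ H) (hL : L' = conjSub g L)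
    (hLH : L ≤ H) (hLH' : L' ≤ H) (x : M.val H) :
    M.conj g hL (M.res hLH x) = M.res hLH' x := by
  rw [← LinearMap.comp_apply, ← M.res_comp_conj g hL (conjSub_self hg) hLH hLH',
    M.conj_self H g hg, LinearMap.comp_id]

theorem res_ind {K L H : Subgroup G} (hKH : K ≤ H) (hLH : L ≤ H) (y : M.val L) :
    M.res hKH (M.ind hLH y) =
      ∑ᶠ q : DoubleCoset.Quotient (K.subgroupOf H : Set H) (L.subgroupOf H : Set H),
        M.ind (inf_le_left : K ⊓ conjSub (q.out : G) L ≤ K)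
          (M.conj (q.out : G) (inf_conjSub_eq (q.out : G) K L)
            (M.res (inf_le_left : L ⊓ conjSub (q.out : G)⁻¹ K ≤ L) y)) := by
  have : Finite (DoubleCoset.Quotient (K.subgroupOf H : Set H) (L.subgroupOf H : Set H)) :=
    Quotient.finite _
  rw [← LinearMap.comp_apply, M.mackey hKH hLH]
  exact map_finsum (LinearMap.applyₗ y) (Set.toFinite _)

section BurnsideAction

variable {K L H : Subgroup G}

theorem burnsideAct_cls_apply (H : Subgroup G) (X : FinGSet H) (x : M.val H) :
    M.burnsideAct H (cls X) x = FinGSet.orbitSum (fun S => M.indRes H S x) X := by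
  rw [burnsideAct, liftAdditive_cls]
  exact FinGSet.map_orbitSum (LinearMap.applyₗ x) _ X

theorem res_indRes (hKH : K ≤ H) (hLH : L ≤ H) (x : M.val H) :
    M.res hKH (M.indRes H (L.subgroupOf H) x) =
      FinGSet.orbitSum (fun S => M.indRes K S (M.res hKH x))
        ((FinGSet.coset (L.subgroupOf H)).restrict (Subgroup.inclusion hKH)) := by
  rw [FinGSet.orbitSum_restrict_inclusion_coset hKH (fun k S => by rw [M.indRes_conjSub]),
    M.indRes_apply (Subgroup.map_subgroupOf_eq_of_le hLH).symm hLH, M.res_ind]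
  refine finsum_congr fun q => ?_
  have hS : K ⊓ conjSub (q.out : G) L = ((conjSub (q.out : G) L).subgroupOf K).map K.subtype := by
    rw [Subgroup.subgroupOf_map_subtype, inf_comm]
  rw [M.indRes_apply hS inf_le_left, ← LinearMap.comp_apply (M.res _) (M.res hLH), ← M.res_trans,
    M.conj_res_of_mem q.out.2 _ _ (inf_le_left.trans hKH), M.res_trans inf_le_left hKH,
    LinearMap.comp_apply]

theorem res_burnsideAct (hKH : K ≤ H) (b : RatBurnside H) (x : M.val H) :
    M.res hKH (M.burnsideAct H b x) =
      M.burnsideAct K (restrict (Subgroup.inclusion hKH) b) (M.res hKH x) := by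
  suffices h : M.res hKH ∘ₗ LinearMap.applyₗ x ∘ₗ M.burnsideAct H =
      LinearMap.applyₗ (M.res hKH x) ∘ₗ M.burnsideAct K ∘ₗ restrict (Subgroup.inclusion hKH) from
    LinearMap.congr_fun h b
  refine hom_ext_coset fun S => ?_
  obtain ⟨L, hLH, rfl⟩ := exists_eq_subgroupOf S
  simp only [LinearMap.comp_apply, LinearMap.applyₗ_apply_apply, restrict_cls]
  rw [burnsideAct_coset, burnsideAct_cls_apply, M.res_indRes hKH hLH]

theorem indRes_map_inclusion (hLH : L ≤ H) (S : Subgroup L) (x : M.val H) :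
    M.indRes H (S.map (Subgroup.inclusion hLH)) x =
      M.ind hLH (M.indRes L S (M.res hLH x)) := by
  have hS : S.map L.subtype = (S.map (Subgroup.inclusion hLH)).map H.subtype :=
    (Subgroup.map_map S H.subtype (Subgroup.inclusion hLH)).symm
  have hSL := Subgroup.map_subtype_le S
  rw [M.indRes_apply hS (hSL.trans hLH), M.ind_trans hSL hLH, M.res_trans hSL hLH]
  rfl

theorem burnsideAct_coset_mul (hLH : L ≤ H) (b : RatBurnside H) (x : M.val H) :
    M.burnsideAct H (cls (FinGSet.coset (L.subgroupOf H)) * b) x =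
      M.ind hLH (M.burnsideAct L (restrict (Subgroup.inclusion hLH) b) (M.res hLH x)) := by
  suffices h : LinearMap.applyₗ x ∘ₗ M.burnsideAct H ∘ₗ
        LinearMap.mulLeft ℚ (cls (FinGSet.coset (L.subgroupOf H))) =
      M.ind hLH ∘ₗ LinearMap.applyₗ (M.res hLH x) ∘ₗ M.burnsideAct L ∘ₗ
        restrict (Subgroup.inclusion hLH) from LinearMap.congr_fun h b
  refine hom_ext fun X => ?_
  simp only [LinearMap.comp_apply, LinearMap.applyₗ_apply_apply, LinearMap.mulLeft_apply,
    restrict_cls, ← cls_prod, burnsideAct_cls_apply, FinGSet.map_orbitSum,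
    ← indRes_map_inclusion, ← Subgroup.inclusion_range hLH]
  exact FinGSet.orbitSum_coset_range_prod _ (fun h S => by rw [M.indRes_conjSub]) X

theorem burnsideAct_mul (a b : RatBurnside H) (x : M.val H) :
    M.burnsideAct H (a * b) x = M.burnsideAct H a (M.burnsideAct H b x) := by
  suffices h : LinearMap.applyₗ x ∘ₗ M.burnsideAct H ∘ₗ LinearMap.mulRight ℚ b =
      LinearMap.applyₗ (M.burnsideAct H b x) ∘ₗ M.burnsideAct H from LinearMap.congr_fun h a
  refine hom_ext_coset fun S => ?_
  obtain ⟨L, hLH, rfl⟩ := exists_eq_subgroupOf S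
  simp only [LinearMap.comp_apply, LinearMap.applyₗ_apply_apply, LinearMap.mulRight_apply]
  rw [M.burnsideAct_coset_mul hLH, ← M.res_burnsideAct, burnsideAct_coset,
    M.indRes_apply (Subgroup.map_subgroupOf_eq_of_le hLH).symm hLH]

end BurnsideAction

variable {K H : Subgroup G} (hKH : K ≤ H)

theorem burnsideAct_of_mem_idemPart (b : RatBurnside H) {x : M.val H} (hx : x ∈ M.idemPart hKH) :
    M.burnsideAct H b x = mark (K.subgroupOf H) b • x := by
  obtain ⟨z, rfl⟩ := hx
  rw [← burnsideAct_mul, mul_idem, map_smul, LinearMap.smul_apply]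

theorem burnsideAct_idem_of_mem_idemPart {x : M.val H} (hx : x ∈ M.idemPart hKH) :
    M.burnsideAct H (idem (K.subgroupOf H)) x = x := by
  rw [M.burnsideAct_of_mem_idemPart hKH _ hx, mark_idem_self, one_smul]

theorem ind_res_of_mem_idemPart {x : M.val H} (hx : x ∈ M.idemPart hKH) :
    M.ind hKH (M.res hKH x) =
      mark (K.subgroupOf H) (cls (FinGSet.coset (K.subgroupOf H))) • x := by
  rw [← M.burnsideAct_of_mem_idemPart hKH _ hx, burnsideAct_coset,
    M.indRes_apply (Subgroup.map_subgroupOf_eq_of_le hKH).symm hKH]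

theorem res_burnsideAct_idem (x : M.val H) :
    M.res hKH (M.burnsideAct H (idem (K.subgroupOf H)) x) =
      M.burnsideAct K (idem (K.subgroupOf K)) (M.res hKH x) := by
  rw [res_burnsideAct, Subgroup.subgroupOf_self, ← Subgroup.inclusion_range hKH,
    restrict_idem_range (Subgroup.inclusion_injective hKH)]

theorem res_eq_zero_of_mem_idemPart {L : Subgroup G} (hLK : L < K) {y : M.val K}
    (hy : y ∈ M.idemPart (le_refl K)) : M.res hLK.le y = 0 := by
  have card_lt : Nat.card L < Nat.card (K.subgroupOf K) := by
    rw [Subgroup.subgroupOf_self, Subgroup.card_top]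
    exact Set.ncard_lt_ncard hLK
  rw [← M.burnsideAct_idem_of_mem_idemPart le_rfl hy, res_burnsideAct,
    restrict_idem_of_card_lt card_lt, map_zero, LinearMap.zero_apply]

theorem res_mem_invariants (x : M.val H) : M.res hKH x ∈ (M.weylRep hKH).invariants := by
  rintro ⟨n⟩
  exact M.conj_res_of_mem (n : H).2 (eq_conjSub_of_mem_norm hKH n) hKH hKH x

theorem conj_of_mem_invariants {y : M.val K} (hy : y ∈ (M.weylRep hKH).invariants) (h : H)
    (hh : K = conjSub (h : G) K) : M.conj (h : G) hh y = y := by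
  have mem_norm : h ∈ normIn K H := by
    refine Subgroup.mem_normalizer_iff_map_conj_eq.mpr ((conjSub_subgroupOf h K).trans ?_)
    rw [← hh]
  exact hy (QuotientGroup.mk ⟨h, mem_norm⟩)

theorem ind_conj_res_of_mem_invariants {y : M.val K} (hy : y ∈ (M.weylRep hKH).invariants) (h : H)
    (hh : K = conjSub (h : G) K) :
    M.ind (inf_le_left : K ⊓ conjSub (h : G) K ≤ K) (M.conj (h : G) (inf_conjSub_eq (h : G) K K)
      (M.res (inf_le_left : K ⊓ conjSub (h : G)⁻¹ K ≤ K) y)) = y := by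
  have ind_res_of_eq {P : Subgroup G} (hP : P ≤ K) (hPK : P = K) : M.ind hP (M.res hP y) = y := by
    subst hPK
    rw [M.ind_self, M.res_self, LinearMap.id_apply, LinearMap.id_apply]
  rw [← LinearMap.comp_apply (M.conj _ _),
    ← M.res_comp_conj (h : G) (inf_conjSub_eq (h : G) K K) hh inf_le_left inf_le_left,
    LinearMap.comp_apply, M.conj_of_mem_invariants hKH hy h hh,
    ind_res_of_eq _ (inf_eq_left.mpr hh.le)]

theorem ind_conj_res_of_mem_idemPart {y : M.val K} (hy : y ∈ M.idemPart (le_refl K)) {g : G}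
    (hg : K ≠ conjSub g K) :
    M.ind (inf_le_left : K ⊓ conjSub g K ≤ K) (M.conj g (inf_conjSub_eq g K K)
      (M.res (inf_le_left : K ⊓ conjSub g⁻¹ K ≤ K) y)) = 0 := by
  have inf_lt : K ⊓ conjSub g⁻¹ K < K :=
    inf_lt_left.mpr fun h => hg (eq_conjSub_inv_iff.mp (le_conjSub_iff_eq.mp h))
  rw [M.res_eq_zero_of_mem_idemPart inf_lt hy, map_zero, map_zero]

theorem res_ind_of_mem_idemFixed {y : M.val K} (hy : y ∈ M.idemFixed hKH) :
    M.res hKH (M.ind hKH y) =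
      mark (K.subgroupOf H) (cls (FinGSet.coset (K.subgroupOf H))) • y := by
  classical
  -- The scalar counts the `K`-orbits of `H/K` that are single points, hence is a sum over the same
  -- double cosets as the Mackey formula.
  rw [← Subgroup.inclusion_range hKH, MonoidHom.range_eq_map, ← mark_restrict, restrict_cls,
    ← FinGSet.orbitSum_ite_eq_top, ← MonoidHom.range_eq_map, Subgroup.inclusion_range,
    FinGSet.orbitSum_restrict_inclusion_coset hKH
      (fun k S => by simp only [conjSub_eq_top_iff]), res_ind]
  refine finsum_congr fun q => ?_
  have normalizes_iff : (conjSub (q.out : G) K).subgroupOf K = ⊤ ↔ K = conjSub (q.out : G) K := by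
    rw [Subgroup.subgroupOf_eq_top, le_conjSub_iff_eq]
  simp only [normalizes_iff]
  split_ifs with hq
  · exact M.ind_conj_res_of_mem_invariants hKH hy.2 q.out hq
  · exact M.ind_conj_res_of_mem_idemPart hy.1 hq

theorem res_mapsTo_idemFixed : Set.MapsTo (M.res hKH) (M.idemPart hKH) (M.idemFixed hKH) := by
  intro x hx
  refine ⟨?_, M.res_mem_invariants hKH x⟩
  rw [← M.burnsideAct_idem_of_mem_idemPart hKH hx, res_burnsideAct_idem]
  exact LinearMap.mem_range_self _ _

theorem res_injOn_idemPart : Set.InjOn (M.res hKH) (M.idemPart hKH) := by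
  intro x hx x' hx' h
  refine smul_right_injective _ (mark_coset_self_ne_zero (K.subgroupOf H)) ?_
  simp only [← M.ind_res_of_mem_idemPart hKH hx, ← M.ind_res_of_mem_idemPart hKH hx', h]

theorem res_surjOn_idemFixed : Set.SurjOn (M.res hKH) (M.idemPart hKH) (M.idemFixed hKH) := by
  intro y hy
  let scalar := mark (K.subgroupOf H) (cls (FinGSet.coset (K.subgroupOf H)))
  let x := M.burnsideAct H (idem (K.subgroupOf H)) (M.ind hKH y)
  have res_x : M.res hKH x = scalar • y := by
    rw [res_burnsideAct_idem, M.res_ind_of_mem_idemFixed hKH hy, map_smul,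
      M.burnsideAct_idem_of_mem_idemPart le_rfl hy.1]
  refine ⟨scalar⁻¹ • x, Submodule.smul_mem _ _ (LinearMap.mem_range_self _ _), ?_⟩
  rw [map_smul, res_x, inv_smul_smul₀ (mark_coset_self_ne_zero _)]

end RatMackeyFunctor

theorem mainTheorem3 {G : Type u} [Group G] [Finite G] (M : RatMackeyFunctor.{u, v} G)
    {K H : Subgroup G} (hKH : K ≤ H) :
    ∃ φ : M.idemPart hKH ≃ₗ[ℚ] M.idemFixed hKH,
      ∀ x : M.idemPart hKH, (φ x : M.val K) = M.res hKH (x : M.val H) := by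
  have bijOn : Set.BijOn (M.res hKH) (M.idemPart hKH) (M.idemFixed hKH) :=
    ⟨M.res_mapsTo_idemFixed hKH, M.res_injOn_idemPart hKH, M.res_surjOn_idemFixed hKH⟩
  exact ⟨LinearEquiv.ofBijective ((M.res hKH).restrict bijOn.mapsTo) bijOn.bijective, fun _ => rfl⟩
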